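/- **List update with untrusted advice.** A list of $m$ items is to serve a sequence of requests to its items. An access to the item at position $i$ costs $i$; the accessed item may then be moved any distance towards the front for free, and at any time two consecutive items may be exchanged at cost $1$. $\textsc{Opt}(\sigma)$ is the least total cost of serving $\sigma$ offline from the same initial list. *Candidates.* MTFO (resp. MTFE) moves an item to the front on each of its odd-numbered (resp. even-numbered) requests. Timestamp inserts a requested item $x$ in front of the first item of the list that precedes $x$ and was requested at most once since the last request to $x$; if there is none, or if this is the first request to $x$, it does not move $x$. Mtf moves every requested item to the front. *The algorithm Tog* has a parameter $\beta\ge 0$. Its advice string (two bits suffice) names one of MTFO, MTFE and Timestamp. If it names Timestamp, Tog runs Timestamp. Otherwise, let Mtf2 be the algorithm named; Tog alternates between trusting and ignoring phases, beginning with a trusting one. At the beginning of a trusting phase Tog changes its list, by a least number of paid exchanges, to the list that Mtf2 would have at this point had it served the whole sequence so far; it then serves requests as Mtf2 does until the access cost of the phase is at least $m^3$. In an ignoring phase it serves requests by Mtf, starting from its current list, until the access cost of the phase is at least $\beta m^3$ (for $\beta=0$ ignoring phases are empty, and Tog is Mtf2). The advice is *right* (trusted) for $\sigma$ if the algorithm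 that it names has the least cost on $\sigma$ among the three candidates. Untrusted advice is arbitrary. *Competitiveness.* Say that Tog with parameter $\beta$ is $(r,w)$-competitive for long lists if for every $\varepsilon>0$ there is an $m_0$ such that for every $m\ge m_0$ there is a constant $K$ with the following property: for every initial list of length $m$ and every request sequence $\sigma$, the cost of Tog is at most $(r+\varepsilon)\,\textsc{Opt}(\sigma)+K$ with any right advice for $\sigma$, and at most $(w+\varepsilon)\,\textsc{Opt}(\sigma)+K$ with any advice. **Theorem.** For every $\beta\ge 0$, Tog with parameter $\beta$ is $\left(\frac53+\frac{5\beta}{6+3\beta},\ 2+\frac{2}{4+5\beta}\right)$-competitive for long lists. Consequently, for every $r\in[5/3,2]$ there is a $\beta\in[0,1/2]$ with $r=\frac53+\frac{5\beta}{6+3\beta}$, and Tog with this parameter is $(r,f(r))$-competitive for long lists, where $f(r)=2+\frac{10-3r}{9r-5}$. -/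

import Mathlib

namespace ListUpdate

section Model

variable {α : Type*}

/-- One paid exchange: two consecutive items of the list trade places (cost `1`). -/
def AdjSwap (L L' : List α) : Prop :=
  ∃ (A B : List α) (a b : α), L = A ++ a :: b :: B ∧ L' = A ++ b :: a :: B

/-- `Exchanges k L L'`: exactly `k` paid exchanges, one after the other, turn `L` into `L'`. -/
inductive Exchanges : ℕ → List α → List α → Prop
  | refl (L : List α) : Exchanges 0 L L
  | step {k : ℕ} {L L' L'' : List α} :
      AdjSwap L L' → Exchanges k L' L'' → Exchanges (k + 1) L L''

/-- The least number of paid exchanges that turn `L` into `L'` (used only for two orderings of the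
same items, where such a sequence of exchanges exists). -/
noncomputable def exchangeCost (L L' : List α) : ℕ :=
  sInf {k | Exchanges k L L'}

variable [DecidableEq α]

/-- The cost of an access to `x`: its position in the list, counted from `1`. -/
def accessCost (L : List α) (x : α) : ℕ := L.idxOf x + 1

/-- Take `x` out of the list and put it back at index `i` (counted from `0`). For
`i ≤ L.idxOf x` and `x` the item just accessed this is a free move towards the front. -/
def moveTo (L : List α) (x : α) (i : ℕ) : List α := (L.erase x).insertIdx i x

/-- `Serves L σ c`: starting from the list `L`, the request sequence `σ` can be served at total
cost `c`. At any time paid exchanges may be made at cost `1` each; each request pays its access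
cost, after which the accessed item may be moved any distance towards the front for free. -/
inductive Serves : List α → List α → ℕ → Prop
  | done (L : List α) : Serves L [] 0
  | paid {L L' σ : List α} {c : ℕ} : AdjSwap L L' → Serves L' σ c → Serves L σ (c + 1)
  | access {L σ : List α} {x : α} {i c : ℕ} :
      i ≤ L.idxOf x → Serves (moveTo L x i) σ c → Serves L (x :: σ) (accessCost L x + c)

/-- The optimal offline cost of serving `σ` from the initial list `L`. -/
noncomputable def opt (L σ : List α) : ℕ := sInf {c | Serves L σ c}

/-- An online rule that makes free exchanges only: from the past requests (most recent first), the
current list and the item just accessed, it computes the index (counted from `0`) to which this item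
is moved. -/
abbrev Rule (α : Type*) := List α → List α → α → ℕ

/-- The cost of a rule on the remaining requests, when `h` are the past requests (most recent first)
and `L` is the current list. -/
def ruleCost (R : Rule α) : List α → List α → List α → ℕ
  | _, _, [] => 0
  | h, L, x :: σ => accessCost L x + ruleCost R (x :: h) (moveTo L x (R h L x)) σ

/-- Move-To-Front. -/
def mtf : Rule α := fun _ _ _ => 0

/-- `MTFO`: an item is moved to the front on its first, third, fifth, ... request. -/
def mtfo : Rule α := fun h L x => if Even (h.count x) then 0 else L.idxOf x

/-- `MTFE`: an item is moved to the front on its second, fourth, sixth, ... request. -/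
def mtfe : Rule α := fun h L x => if Odd (h.count x) then 0 else L.idxOf x

/-- `Timestamp`: on a request to `x`, insert `x` in front of the first item of the list that precedes
`x` and was requested at most once since the last request to `x`. If there is no such item, or if `x`
is requested for the first time, do not move `x`. (The item `x` itself passes the test in `findIdx`,
so the index found is at most that of `x`, with equality if no preceding item passes.) -/
def timestamp : Rule α := fun h L x =>
  if x ∈ h then L.findIdx (fun y => decide ((h.takeWhile (fun z => decide (z ≠ x))).count y ≤ 1))
  else L.idxOf x

end Model

/-- The three algorithms that the advice can name. -/
inductive Candidate
  | timestamp
  | mtfo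
  | mtfe

/-- The rule of a candidate algorithm. -/
def Candidate.rule {α : Type*} [DecidableEq α] : Candidate → Rule α
  | .timestamp => ListUpdate.timestamp
  | .mtfo => ListUpdate.mtfo
  | .mtfe => ListUpdate.mtfe

/-- The candidate algorithm that an advice string names; only the first two bits matter. -/
def decode : List Bool → Candidate
  | true :: false :: _ => .mtfo
  | true :: true :: _ => .mtfe
  | _ => .timestamp

section Toggle

variable {α : Type*}

/-- What the phased algorithm remembers: the past requests (most recent first), the list that the
indicated algorithm `MTF2` would have at this point had it served all requests so far, its own list,
the type of the current phase, and the access cost it has paid in the current phase. -/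
structure TogState (α : Type*) where
  history : List α
  simulated : List α
  current : List α
  trusting : Bool
  phaseCost : ℕ

/-- A trusting phase is over once its access cost is at least `m ^ 3`; an ignoring phase follows. -/
def TogState.endTrusting (m : ℕ) (s : TogState α) : TogState α :=
  if s.trusting = true ∧ m ^ 3 ≤ s.phaseCost then
    { s with trusting := false, phaseCost := 0 }
  else s

/-- An ignoring phase is over once its access cost is at least `β * m ^ 3`. -/
def TogState.IgnoringOver (m : ℕ) (β : ℝ) (s : TogState α) : Prop :=
  s.trusting = false ∧ β * (m : ℝ) ^ 3 ≤ (s.phaseCost : ℝ)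

open Classical in
/-- After an ignoring phase a trusting phase follows. At its beginning the list is changed, by paid
exchanges, to the one that `MTF2` would have. -/
noncomputable def TogState.endIgnoring (m : ℕ) (β : ℝ) (s : TogState α) : TogState α :=
  if s.IgnoringOver m β then
    { s with current := s.simulated, trusting := true, phaseCost := 0 }
  else s

open Classical in
/-- The cost of the paid exchanges made by `TogState.endIgnoring`. -/
noncomputable def TogState.paidCost (m : ℕ) (β : ℝ) (s : TogState α) : ℕ :=
  if s.IgnoringOver m β then exchangeCost s.current s.simulated else 0

variable [DecidableEq α]

/-- Serve a request to `x`: as `MTF2` (given by its rule `R`) in a trusting phase, by Move-To-Front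
in an ignoring phase. -/
def TogState.serve (R : Rule α) (s : TogState α) (x : α) : TogState α where
  history := x :: s.history
  simulated := moveTo s.simulated x (R s.history s.simulated x)
  current := moveTo s.current x
    (if s.trusting = true then R s.history s.current x else mtf s.history s.current x)
  trusting := s.trusting
  phaseCost := s.phaseCost + accessCost s.current x

/-- The cost of toggling between the rule `R` and Move-To-Front on the remaining requests, from the
state `s`. Phases that are over are closed when the next request arrives. -/
noncomputable def toggleCost (m : ℕ) (β : ℝ) (R : Rule α) : TogState α → List α → ℕ
  | _, [] => 0
  | s, x :: σ =>
      let s₁ := s.endTrusting m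
      let s₂ := s₁.endIgnoring m β
      s₁.paidCost m β + accessCost s₂.current x + toggleCost m β R (s₂.serve R x) σ

/-- The cost of `Tog` with parameter `β` and advice `φ` on the request sequence `σ`, from the initial
list `L`, whose length is `m`. If the advice names Timestamp, then Timestamp serves all requests;
otherwise `Tog` toggles, starting with a trusting phase. -/
noncomputable def togCost (m : ℕ) (β : ℝ) (L : List α) (φ : List Bool) (σ : List α) : ℕ :=
  match decode φ with
  | .timestamp => ruleCost timestamp [] L σ
  | .mtfo => toggleCost m β mtfo ⟨[], L, L, true, 0⟩ σ
  | .mtfe => toggleCost m β mtfe ⟨[], L, L, true, 0⟩ σ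

/-- The advice `φ` is right: it names a candidate whose cost on `σ` is least among the three. -/
def Trusted (L : List α) (φ : List Bool) (σ : List α) : Prop :=
  ∀ A : Candidate, ruleCost (decode φ).rule [] L σ ≤ ruleCost A.rule [] L σ

/-- For every request sequence there is right advice (of two bits). -/
theorem exists_trusted (L σ : List α) : ∃ φ : List Bool, φ.length = 2 ∧ Trusted L φ σ := by
  have key : ∃ A : Candidate, ∀ B : Candidate,
      ruleCost A.rule [] L σ ≤ ruleCost B.rule [] L σ := by
    have : Nonempty Candidate := ⟨.mtfo⟩
    exact ⟨Function.argmin (fun A : Candidate => ruleCost A.rule [] L σ), fun B =>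
      Function.argmin_le (fun A : Candidate => ruleCost A.rule [] L σ) B⟩
  obtain ⟨A, hA⟩ := key
  cases A
  · exact ⟨[false, false], rfl, hA⟩
  · exact ⟨[true, false], rfl, hA⟩
  · exact ⟨[true, true], rfl, hA⟩

end Toggle

/-- On lists of length `m`, `Tog` with parameter `β` has (asymptotic) competitive ratio at most `r`
with trusted advice and at most `w` with untrusted (adversarial) advice: the cost is at most the ratio
times the optimal offline cost, plus a constant that does not depend on the request sequence, for
every ordering `L` of the `m` items as initial list. -/
def TogCompetitiveOn (m : ℕ) (β r w : ℝ) : Prop :=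
  ∃ K : ℝ, ∀ L : List (Fin m), L.Perm (List.finRange m) → ∀ σ : List (Fin m),
    (∀ φ : List Bool, Trusted L φ σ →
      (togCost m β L φ σ : ℝ) ≤ r * (opt L σ : ℝ) + K) ∧
    (∀ φ : List Bool, (togCost m β L φ σ : ℝ) ≤ w * (opt L σ : ℝ) + K)

/-- `Tog` with parameter `β` is `(r, w)`-competitive for long lists: as the length of the list grows,
its two competitive ratios converge to values of at most `r` and `w`. -/
def TogCompetitive (β r w : ℝ) : Prop :=
  ∀ ε : ℝ, 0 < ε → ∃ m₀ : ℕ, ∀ m : ℕ, m₀ ≤ m → TogCompetitiveOn m β (r + ε) (w + ε)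

end ListUpdate

/-! Everything is amortized over pairs of items. An access to `x` costs `1` plus the number of items
in front of `x`, so costs split into contributions of pairs. A potential of a pair depends on a few
bits: the order in the adversary's list, the order in each algorithm's list, parities of request
counts, and the interleaving of recent requests. Once these bits are known to evolve by a finite
rule, each amortized inequality is a finite check. This shows that Move-To-Front (`mtf_step`) and
Timestamp (`timestamp_competitive`) are `2`-competitive, that alternating rules are
`5/2`-competitive (`IsAlternating.step`), and that MTFO, MTFE and Timestamp together pay at most `5`
times the optimum (`joint_competitive`). Hence the best of the three is `5/3`-competitive.

Toggling is compared with an adversary against which the trusted rule has ratio `κ` and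
Move-To-Front has ratio `2`. Up to lower-order terms, a round of phases costs `(1 + β) m ^ 3`, while
the adversary pays at least `(1 / κ + β / 2) m ^ 3`. Changing lists and restarting potentials costs
only `O(m ^ 2)`, negligible for long lists. So the ratio tends to `(1 + β) / (1 / κ + β / 2)`
(`toggleCost_le`). With the optimum as adversary and `κ = 5/2` this is `2 + 2 / (4 + 5 * β)`. With
the trusted rule itself as adversary and `κ = 1` it is `(2 + 2 * β) / (2 + β)`, and the factor `5/3`
for right advice gives the first ratio. -/

namespace ListUpdate

/-! ### Relative orders of items and the effect of a free move -/

section Order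

variable {α : Type*} [DecidableEq α]

/-- A listing of a type: every item occurs exactly once. -/
structure IsListing {α : Type*} (L : List α) : Prop where
  nodup : L.Nodup
  complete : ∀ x, x ∈ L

/-- `before L x y`: the item `x` precedes the item `y` in the list `L`. -/
def before (L : List α) (x y : α) : Bool := decide (L.idxOf x < L.idxOf y)

theorem IsListing.perm {α : Type*} {L L' : List α} (h : IsListing L) (hp : L.Perm L') : IsListing L' :=
  ⟨hp.nodup_iff.1 h.nodup, fun x => hp.mem_iff.1 (h.complete x)⟩

theorem IsListing.idxOf_lt {L : List α} (h : IsListing L) (x : α) : L.idxOf x < L.length :=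
  List.idxOf_lt_length_of_mem (h.complete x)

theorem IsListing.idxOf_ne {L : List α} (h : IsListing L) {x y : α} (hxy : x ≠ y) :
    L.idxOf x ≠ L.idxOf y :=
  fun e => hxy ((List.idxOf_inj (h.complete x)).1 e)

theorem IsListing.before_swap {L : List α} (h : IsListing L) {x y : α} (hxy : x ≠ y) :
    before L y x = !before L x y := by
  have := h.idxOf_ne hxy
  by_cases h1 : L.idxOf x < L.idxOf y
  · simp [before, h1, h1.le]
  · simp [before, h1]; omega

theorem IsListing.length_eq_card [Fintype α] {L : List α} (h : IsListing L) :
    L.length = Fintype.card α := by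
  rw [← List.toFinset_card_of_nodup h.nodup, ← Finset.card_univ]
  congr 1
  ext x; simp [h.complete x]

/-- Each item in front of `x` contributes one unit: this is what reduces access costs to pairs. -/
theorem IsListing.idxOf_eq_sum [Fintype α] {L : List α} (h : IsListing L) (x : α) :
    L.idxOf x = ∑ y ∈ Finset.univ.erase x, (before L y x).toNat := by
  have h1 : ∑ y ∈ Finset.univ.erase x, (before L y x).toNat
      = (Finset.univ.filter (fun y => L.idxOf y < L.idxOf x)).card := by
    rw [Finset.card_filter, ← Finset.sum_erase (a := x) Finset.univ (by simp)]
    refine Finset.sum_congr rfl fun y _ => ?_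
    by_cases hy : L.idxOf y < L.idxOf x <;> simp [before, hy]
  rw [h1]
  have h2 : (Finset.univ.filter (fun y => L.idxOf y < L.idxOf x)).image (fun y => L.idxOf y)
      = Finset.range (L.idxOf x) := by
    ext k
    simp only [Finset.mem_image, Finset.mem_filter, Finset.mem_univ, true_and, Finset.mem_range]
    constructor
    · rintro ⟨y, hy, rfl⟩; exact hy
    · intro hk
      have hk' : k < L.length := hk.trans (h.idxOf_lt x)
      exact ⟨L[k], by rw [h.nodup.idxOf_getElem]; exact hk, h.nodup.idxOf_getElem k hk'⟩
  rw [← Finset.card_image_of_injective _ (fun a b hab => (List.idxOf_inj (h.complete a)).1 hab), h2,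
    Finset.card_range]

theorem exists_split_moveTo {L : List α} (h : IsListing L) {x : α} {i : ℕ} (hi : i ≤ L.idxOf x) :
    ∃ A B C : List α, L = A ++ B ++ x :: C ∧ moveTo L x i = A ++ x :: (B ++ C) ∧ A.length = i := by
  obtain ⟨D, C, hL, hD⟩ : ∃ D C, L = D ++ x :: C ∧ x ∉ D := by
    obtain ⟨D, C, hL⟩ := List.append_of_mem (h.complete x)
    refine ⟨D, C, hL, fun hx => ?_⟩
    have := h.nodup
    rw [hL, List.nodup_append] at this
    exact this.2.2 x hx x (by simp) rfl
  have hidx : L.idxOf x = D.length := by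
    rw [hL, List.idxOf_append_of_notMem hD]; simp
  refine ⟨D.take i, D.drop i, C, by simp [hL], ?_, by simp; omega⟩
  have he : L.erase x = D.take i ++ (D.drop i ++ C) := by
    rw [hL, List.erase_append_right _ hD, ← List.append_assoc, List.take_append_drop]; simp
  have hlen : (D.take i).length = i := by simp; omega
  rw [moveTo, he]
  have ins : ∀ A E : List α, (A ++ E).insertIdx A.length x = A ++ x :: E := by
    intro A E
    induction A with
    | nil => simp
    | cons a A ih => simpa using ih
  simpa [hlen] using ins (D.take i) (D.drop i ++ C)

theorem IsListing.moveTo {L : List α} (h : IsListing L) {x : α} {i : ℕ} (hi : i ≤ L.idxOf x) :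
    IsListing (moveTo L x i) := by
  obtain ⟨A, B, C, h1, h2, -⟩ := exists_split_moveTo h hi
  rw [h2]
  rw [h1] at h
  refine h.perm ?_
  rw [List.append_assoc]
  exact List.Perm.append_left A List.perm_middle

theorem before_moveTo_of_ne {L : List α} (h : IsListing L) {x y z : α} {i : ℕ}
    (hi : i ≤ L.idxOf x) (hy : y ≠ x) (hz : z ≠ x) :
    before (moveTo L x i) y z = before L y z := by
  obtain ⟨A, B, C, h1, h2, -⟩ := exists_split_moveTo h hi
  rw [before, before, h2, h1, decide_eq_decide]
  have hA := fun w => List.idxOf_lt_length_of_mem (l := A) (a := w)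
  have hB := fun w => List.idxOf_lt_length_of_mem (l := B) (a := w)
  have pos : ∀ w, w ≠ x →
      (A ++ B ++ x :: C).idxOf w = (if w ∈ A then A.idxOf w else
        if w ∈ B then A.length + B.idxOf w else A.length + B.length + 1 + C.idxOf w) ∧
      (A ++ x :: (B ++ C)).idxOf w = (if w ∈ A then A.idxOf w else
        if w ∈ B then A.length + 1 + B.idxOf w else A.length + B.length + 1 + C.idxOf w) := by
    intro w hw
    by_cases h1 : w ∈ A <;> by_cases h2 : w ∈ B <;>
      simp [List.idxOf_append, List.idxOf_cons_ne _ hw.symm, h1, h2] <;> omega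
  rw [(pos y hy).1, (pos y hy).2, (pos z hz).1, (pos z hz).2]
  grind

theorem before_moveTo_self {L : List α} (h : IsListing L) {x y : α} {i : ℕ}
    (hi : i ≤ L.idxOf x) (hy : y ≠ x) :
    before (moveTo L x i) y x = decide (L.idxOf y < i) := by
  obtain ⟨A, B, C, h1, h2, h3⟩ := exists_split_moveTo h hi
  have hn := h.nodup
  have hxA : x ∉ A := by
    intro hx
    rw [h1, List.append_assoc, List.nodup_append] at hn
    exact hn.2.2 x hx x (by simp) rfl
  rw [before, h2, ← h3, h1]
  by_cases hyA : y ∈ A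
  · have := List.idxOf_lt_length_of_mem hyA
    simp [List.idxOf_append, hxA, hyA, this]
  · simp [List.idxOf_append, hxA, hyA, hy.symm]

theorem moveTo_before_of_ne {L : List α} (h : IsListing L) {x y : α} {i : ℕ}
    (hi : i ≤ L.idxOf x) (hy : y ≠ x) :
    before (moveTo L x i) x y = decide (i ≤ L.idxOf y) := by
  rw [(h.moveTo hi).before_swap hy, before_moveTo_self h hi hy, ← decide_not]
  simp

end Order

/-! ### Paid exchanges and the offline adversary -/

section Swaps

variable {α : Type*} [DecidableEq α]

theorem AdjSwap.perm {α : Type*} {L L' : List α} (h : AdjSwap L L') : L.Perm L' := by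
  obtain ⟨A, B, a, b, rfl, rfl⟩ := h
  exact List.Perm.append_left A (List.Perm.swap b a B)

theorem Exchanges.perm {α : Type*} {k : ℕ} {L L' : List α} (h : Exchanges k L L') :
    L.Perm L' := by
  induction h with
  | refl L => exact List.Perm.refl L
  | step h1 _ ih => exact h1.perm.trans ih

/-- A paid exchange changes the relative order of one pair of items only. -/
theorem AdjSwap.before_eq {L L' : List α} (h : IsListing L) (hs : AdjSwap L L') :
    ∃ a b, a ≠ b ∧ ∀ x y, x ≠ y → ¬(x = a ∧ y = b) → ¬(x = b ∧ y = a) →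
      before L' x y = before L x y := by
  obtain ⟨A, B, a, b, rfl, rfl⟩ := hs
  have hn := h.nodup
  have hab : a ≠ b := by
    rintro rfl
    simp [List.nodup_append] at hn
  refine ⟨a, b, hab, fun x y hxy h1 h2 => ?_⟩
  rw [before, before, decide_eq_decide]
  have hA := fun w => List.idxOf_lt_length_of_mem (l := A) (a := w)
  have haA : a ∉ A := fun ha => by
    rw [List.nodup_append] at hn
    exact hn.2.2 a ha a (by simp) rfl
  have hbA : b ∉ A := fun hb => by
    rw [List.nodup_append] at hn
    exact hn.2.2 b hb b (by simp) rfl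
  have pos : ∀ w,
      (A ++ a :: b :: B).idxOf w = (if w ∈ A then A.idxOf w else if w = a then A.length else
        if w = b then A.length + 1 else A.length + 2 + B.idxOf w) ∧
      (A ++ b :: a :: B).idxOf w = (if w ∈ A then A.idxOf w else if w = a then A.length + 1 else
        if w = b then A.length else A.length + 2 + B.idxOf w) := by
    intro w
    by_cases hwA : w ∈ A
    · simp [List.idxOf_append, hwA]
    by_cases hwa : w = a
    · subst hwa
      simp [List.idxOf_append, hwA, List.idxOf_cons_ne _ hab.symm]
      omega
    by_cases hwb : w = b
    · subst hwb
      simp [List.idxOf_append, hwA, hwa, List.idxOf_cons_ne _ hab]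
      omega
    · simp [List.idxOf_append, hwA, hwa, hwb, List.idxOf_cons_ne _ (Ne.symm hwa),
        List.idxOf_cons_ne _ (Ne.symm hwb)]
      omega
  rw [(pos x).1, (pos x).2, (pos y).1, (pos y).2]
  have hAx := hA x
  have hAy := hA y
  clear pos hA hn h
  split_ifs <;> simp_all <;> omega

theorem exchanges_cons {α : Type*} {k : ℕ} {L L' : List α} (a : α) (h : Exchanges k L L') :
    Exchanges k (a :: L) (a :: L') := by
  induction h with
  | refl L => exact Exchanges.refl _
  | step h1 _ ih =>
    obtain ⟨A, B, x, y, rfl, rfl⟩ := h1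
    exact Exchanges.step ⟨a :: A, B, x, y, rfl, rfl⟩ ih

theorem Exchanges.trans {α : Type*} {j k : ℕ} {L L' L'' : List α} (h : Exchanges j L L')
    (h' : Exchanges k L' L'') : Exchanges (j + k) L L'' := by
  induction h with
  | refl L => simpa using h'
  | step h1 _ ih =>
    rw [Nat.add_right_comm]
    exact Exchanges.step h1 (ih h')

theorem exchanges_to_front {α : Type*} (A B : List α) (a : α) :
    Exchanges A.length (A ++ a :: B) (a :: (A ++ B)) := by
  induction A with
  | nil => exact Exchanges.refl _
  | cons c A ih =>
    exact (exchanges_cons c ih).trans (Exchanges.step ⟨[], A ++ B, c, a, rfl, rfl⟩ (Exchanges.refl _))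

/-- Bring the head of the target to the front, then recurse on the tails. The crude square is
enough, since a trusting phase has access cost about `m ^ 3`. -/
theorem exists_exchanges {α : Type*} {L' L : List α} (h : L.Perm L') :
    ∃ k ≤ L.length ^ 2, Exchanges k L L' := by
  induction L' generalizing L with
  | nil => exact ⟨0, by simp, by rw [h.eq_nil]; exact Exchanges.refl _⟩
  | cons a T ih =>
    obtain ⟨A, B, rfl⟩ := List.append_of_mem (h.mem_iff.2 (List.mem_cons_self))
    obtain ⟨k, hk, hex⟩ := ih (L := A ++ B) (List.Perm.cons_inv (List.perm_middle.symm.trans h))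
    refine ⟨A.length + k, ?_, (exchanges_to_front A B a).trans (exchanges_cons a hex)⟩
    simp only [List.length_append, List.length_cons] at hk ⊢
    have e : (A.length + (B.length + 1)) ^ 2 =
        (A.length + B.length) ^ 2 + 2 * A.length + 2 * B.length + 1 := by ring
    omega

theorem exchangeCost_le {α : Type*} {L L' : List α} (h : L.Perm L') :
    exchangeCost L L' ≤ L.length ^ 2 := by
  obtain ⟨k, hk, hex⟩ := exists_exchanges h
  exact (Nat.sInf_le hex).trans hk

/-- The first request is served after some paid exchanges. -/
theorem Serves.exists_access {L σ : List α} {x : α} {c : ℕ} (h : Serves L (x :: σ) c) :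
    ∃ k L' i c', Exchanges k L L' ∧ i ≤ L'.idxOf x ∧ Serves (moveTo L' x i) σ c' ∧
      c = k + accessCost L' x + c' := by
  generalize hτ : x :: σ = τ at h
  induction h with
  | done L => simp at hτ
  | paid h1 _ ih =>
    obtain ⟨k, L', i, c', h2, h3, h4, rfl⟩ := ih hτ
    exact ⟨k + 1, L', i, c', Exchanges.step h1 h2, h3, h4, by ring⟩
  | access h1 h2 =>
    obtain ⟨rfl, rfl⟩ := List.cons.inj hτ
    exact ⟨0, _, _, _, Exchanges.refl _, h1, h2, by ring⟩

/-- A rule that moves items towards the front only is one way of serving the requests. -/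
theorem serves_ruleCost {R : Rule α} (hR : ∀ h L x, IsListing L → R h L x ≤ L.idxOf x)
    (σ h L : List α) (hL : IsListing L) : Serves L σ (ruleCost R h L σ) := by
  induction σ generalizing h L with
  | nil => exact Serves.done L
  | cons x σ ih => exact Serves.access (hR h L x hL) (ih _ _ (hL.moveTo (hR h L x hL)))

theorem serves_opt {L : List α} (hL : IsListing L) (σ : List α) : Serves L σ (opt L σ) :=
  Nat.sInf_mem (s := {c | Serves L σ c})
    ⟨_, serves_ruleCost (R := mtf) (fun _ _ _ _ => Nat.zero_le _) σ [] L hL⟩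

end Swaps

/-! ### Summing pairwise potentials -/

section PairPotential

variable {α : Type*} [DecidableEq α] [Fintype α]

/-- The sum over all ordered pairs of distinct items of a potential that depends on the pair and on
its relative order in the list `L`. -/
def pairSum (G : α → α → Bool → ℕ) (L : List α) : ℕ :=
  ∑ p ∈ Finset.univ.offDiag, G p.1 p.2 (before L p.1 p.2)

theorem pairSum_le {G : α → α → Bool → ℕ} {c : ℕ} (hG : ∀ x y o, x ≠ y → G x y o ≤ c)
    (L : List α) : pairSum G L ≤ c * Fintype.card α ^ 2 := by
  refine (Finset.sum_le_card_nsmul _ _ c fun p hp => hG _ _ _ (by simpa using hp)).trans ?_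
  rw [Finset.offDiag_card, smul_eq_mul, mul_comm, Finset.card_univ, pow_two]
  exact Nat.mul_le_mul_left _ (Nat.sub_le _ _)

theorem pairSum_adjSwap {G : α → α → Bool → ℕ} {c : ℕ} (hG : ∀ x y o, x ≠ y → G x y o ≤ c)
    {L L' : List α} (hL : IsListing L) (hs : AdjSwap L L') :
    pairSum G L' ≤ pairSum G L + 2 * c := by
  obtain ⟨a, b, hab, hb⟩ := hs.before_eq hL
  have h1 : pairSum G L' ≤ ∑ p ∈ (Finset.univ : Finset α).offDiag,
      (G p.1 p.2 (before L p.1 p.2) + if p ∈ ({(a, b), (b, a)} : Finset (α × α)) then c else 0) := by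
    refine Finset.sum_le_sum fun p hp => ?_
    have hp' : p.1 ≠ p.2 := by simpa using hp
    split_ifs with h
    · exact (hG _ _ _ hp').trans (Nat.le_add_left _ _)
    · simp only [Finset.mem_insert, Finset.mem_singleton, Prod.ext_iff, not_or] at h
      rw [hb _ _ hp' h.1 h.2]; simp
  refine h1.trans ?_
  rw [Finset.sum_add_distrib, ← Finset.sum_filter]
  refine Nat.add_le_add_left ?_ _
  rw [Finset.sum_const, smul_eq_mul]
  refine Nat.mul_le_mul_right _ ((Finset.card_le_card (t := {(a, b), (b, a)}) ?_).trans
    (Finset.card_le_two))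
  intro p hp
  exact (Finset.mem_filter.1 hp).2

theorem pairSum_exchanges {G : α → α → Bool → ℕ} {c : ℕ} (hG : ∀ x y o, x ≠ y → G x y o ≤ c)
    {k : ℕ} {L L' : List α} (hL : IsListing L) (hs : Exchanges k L L') :
    pairSum G L' ≤ pairSum G L + 2 * c * k := by
  induction hs with
  | refl L => simp
  | step h1 _ ih =>
    have := ih (hL.perm h1.perm)
    have := pairSum_adjSwap hG hL h1
    linarith

theorem sum_offDiag_eq (F : α → α → ℕ) (x : α) :
    ∑ p ∈ Finset.univ.offDiag, F p.1 p.2 =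
      ∑ p ∈ (Finset.univ.erase x).offDiag, F p.1 p.2
        + ∑ y ∈ Finset.univ.erase x, (F x y + F y x) := by
  have h : (Finset.univ : Finset α).offDiag = (Finset.univ.erase x).offDiag ∪
      ((Finset.univ.erase x).image (fun y => (x, y)) ∪
        (Finset.univ.erase x).image (fun y => (y, x))) := by
    ext ⟨a, b⟩
    simp only [Finset.mem_offDiag, Finset.mem_union, Finset.mem_image, Finset.mem_erase,
      Finset.mem_univ, and_true, true_and, Prod.mk.injEq]
    by_cases ha : a = x <;> by_cases hb : b = x <;> simp [ha, hb] <;> grind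
  rw [h, Finset.sum_union, Finset.sum_union, Finset.sum_image (by simp), Finset.sum_image (by simp),
    ← Finset.sum_add_distrib]
  · rw [Finset.disjoint_left]
    rintro ⟨a, b⟩
    simp only [Finset.mem_image, Finset.mem_erase, Finset.mem_univ, and_true, Prod.mk.injEq]
    grind
  · rw [Finset.disjoint_left]
    rintro ⟨a, b⟩
    simp only [Finset.mem_union, Finset.mem_offDiag, Finset.mem_image, Finset.mem_erase,
      Finset.mem_univ, and_true, Prod.mk.injEq]
    grind

/-- One request, served after `k` paid exchanges and followed by a free move: the pairwise
inequalities add up. -/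
theorem pairSum_step {G G' : α → α → Bool → ℕ} {A : α → ℕ} {c k i : ℕ} {x : α} {L L' : List α}
    (hL : IsListing L) (hex : Exchanges k L L') (hi : i ≤ L'.idxOf x)
    (hG : ∀ y z o, y ≠ z → G y z o ≤ c)
    (hne : ∀ y z o, y ≠ x → z ≠ x → y ≠ z → G' y z o ≤ G y z o)
    (hl : ∀ y, y ≠ x → ∀ o o' : Bool, (o → o') → G' x y o' + A y ≤ G x y o + c * (!o).toNat)
    (hr : ∀ y, y ≠ x → ∀ o o' : Bool, (o' → o) → G' y x o' + A y ≤ G y x o + c * o.toNat) :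
    pairSum G' (moveTo L' x i) + 2 * ∑ y ∈ Finset.univ.erase x, A y + 2 * c ≤
      pairSum G L + 2 * c * (k + accessCost L' x) := by
  have hL' := hL.perm hex.perm
  have h1 := pairSum_exchanges hG hL hex
  -- Each exchange affects one pair in both orders, hence at most `2 * c`; the extra `2 * c` on the
  -- left is the `1` in the adversary's access cost.
  suffices h2 : pairSum G' (moveTo L' x i) + 2 * ∑ y ∈ Finset.univ.erase x, A y ≤
      pairSum G L' + 2 * c * L'.idxOf x by
    rw [accessCost]; linarith
  have e := hL'.idxOf_eq_sum x
  rw [pairSum, pairSum, sum_offDiag_eq (fun y z => G' y z (before (moveTo L' x i) y z)) x,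
    sum_offDiag_eq (fun y z => G y z (before L' y z)) x, e, mul_assoc 2 c, add_assoc, add_assoc,
    Finset.mul_sum, Finset.mul_sum, Finset.mul_sum, ← Finset.sum_add_distrib,
    ← Finset.sum_add_distrib]
  refine Nat.add_le_add (Finset.sum_le_sum fun p hp => ?_) (Finset.sum_le_sum fun y hy => ?_)
  · simp only [Finset.mem_offDiag, Finset.mem_erase, Finset.mem_univ, and_true] at hp
    rw [before_moveTo_of_ne hL' hi hp.1 hp.2.1]
    exact hne _ _ _ hp.1 hp.2.1 hp.2.2
  · have hyx : y ≠ x := Finset.ne_of_mem_erase hy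
    have b1 := before_moveTo_self hL' hi hyx
    have b2 := moveTo_before_of_ne hL' hi hyx
    have b3 := hL'.before_swap hyx
    -- A free move goes forward only, so `x` keeps its place in front of every item it already
    -- preceded. Both orders of the pair charge the adversary for `y` in front of `x`.
    have h3 := hl y hyx (before L' x y) (before (moveTo L' x i) x y) (by
      rw [b2]; simp only [before, decide_eq_true_eq]; omega)
    have h4 := hr y hyx (before L' y x) (before (moveTo L' x i) y x) (by
      rw [b1]; simp only [before, decide_eq_true_eq]; omega)
    rw [b3, Bool.not_not] at h3
    rw [b3]
    linarith

end PairPotential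

/-! ### Finite checks on a single pair of items -/

section Pairs

/-- The potential of Move-To-Front on a pair of items: `l` and `o` tell whether the first of them is
in front in the list of the algorithm and in the adversary's list. -/
def mtfPot (l o : Bool) : ℕ := if l = o then 0 else 1

theorem mtfPot_le : ∀ l o, mtfPot l o ≤ 2 := by decide

/-- `_fst` and `_snd` treat a request to the first and to the second item of the pair. The algorithm
pays `1` if the other item is in front in its list, the adversary likewise; the coefficient of the
adversary's cost is the ratio. -/
theorem mtfPot_fst : ∀ l o o' : Bool, (o → o') →
    mtfPot true o' + (!l).toNat ≤ mtfPot l o + 2 * (!o).toNat := by decide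

theorem mtfPot_snd : ∀ l o o' : Bool, (o' → o) →
    mtfPot false o' + l.toNat ≤ mtfPot l o + 2 * o.toNat := by decide

/-- The potential (scaled by `2`) on a pair of items of an algorithm that moves an item to the front
on every other request; `p` and `q` tell whether it stays put on its next request. -/
def alternatingPot (p q l o : Bool) : ℕ :=
  (1 - (if o then q else p).toNat) + if l = o then 0 else 2 + 2 * (if o then p else q).toNat

theorem alternatingPot_le : ∀ p q l o, alternatingPot p q l o ≤ 5 := by decide

/-- Costs are doubled, so the coefficient `5` means ratio `5 / 2`. The requested item toggles its
parity and moves only if it was not due to stay. -/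
theorem alternatingPot_fst : ∀ p q l o o' : Bool, (o → o') →
    alternatingPot (!p) q (if p then l else true) o' + 2 * (!l).toNat ≤
      alternatingPot p q l o + 5 * (!o).toNat := by decide

theorem alternatingPot_snd : ∀ p q l o o' : Bool, (o' → o) →
    alternatingPot p (!q) (if q then l else false) o' + 2 * l.toNat ≤
      alternatingPot p q l o + 5 * o.toNat := by decide

/-- How the last two requests to each of two items `x` and `y` may interleave: `a`, `b`, `c`, `d` tell
whether the last, second last, last, second last request to `x` is more recent than the last, last,
second last, second last request to `y`, respectively. -/
def interleaved (a b c d : Bool) : Bool := (!b || a) && (!b || d) && (!a || c) && (!d || c)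

/-- The potential of Timestamp on a pair of items. -/
def timestampPot (a b c d o : Bool) : ℕ :=
  if b then 2 * (!o).toNat else if !c then 2 * o.toNat
  else if a = d then (if o = d then 0 else 1) else 1

theorem timestampPot_le : ∀ a b c d o, timestampPot a b c d o ≤ 2 := by decide

/-- After a request to `x` its last request is the newest and its former last becomes the second
last: the bits `a b c d` turn into `true a true c`. Timestamp's order is the bit `d`. -/
theorem timestampPot_fst : ∀ a b c d : Bool, interleaved a b c d → ∀ o o' : Bool, (o → o') →
    timestampPot true a true c o' + (!d).toNat ≤ timestampPot a b c d o + 2 * (!o).toNat := by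
  decide

theorem timestampPot_snd : ∀ a b c d : Bool, interleaved a b c d → ∀ o o' : Bool, (o' → o) →
    timestampPot false false a b o' + d.toNat ≤ timestampPot a b c d o + 2 * o.toNat := by
  decide

/-- The joint potential of MTFO, MTFE and Timestamp on a pair of items; `l` and `r` describe the
lists of MTFO and MTFE. -/
def jointPot (l r a b c d o : Bool) : ℕ :=
  if b then 5 * (!o).toNat else if !c then 5 * o.toNat
  else if a = d then (if l = r then (if o = d then 0 else 4) else (if o = d then 1 else 2)) else 2

theorem jointPot_le : ∀ l r a b c d o, jointPot l r a b c d o ≤ 5 := by decide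

/-- The orders `l` and `r` in the lists of MTFO and MTFE that are compatible with the parities `p` and
`q` of the numbers of requests and with the interleaving of the most recent requests. -/
def compatible (p q l r a b c d : Bool) : Bool :=
  interleaved a b c d &&
  if b then l && r else if !c then !l && !r
  else if a then (if d then (l == (p || !q)) && (r == (!p || q)) else (l == p) && (r == !p))
  else if d then (l == !q) && (r == q) else (l == (p && !q)) && (r == (!p && q))

/-- The lists of MTFO and MTFE cannot be arbitrary. For example, two requests to `x` since the last
one to `y` put `x` in front in both, as each rule acts on exactly one of them. Without this
invariant the joint bound would have to cover unreachable states. -/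
theorem compatible_fst : ∀ p q l r a b c d : Bool, compatible p q l r a b c d →
    compatible (!p) q (if p then l else true) (if !p then r else true) true a true c := by
  decide

theorem compatible_snd : ∀ p q l r a b c d : Bool, compatible p q l r a b c d →
    compatible p (!q) (if q then l else false) (if !q then r else false) false false a b := by
  decide

theorem jointPot_fst : ∀ p q l r a b c d : Bool, compatible p q l r a b c d →
    ∀ o o' : Bool, (o → o') →
    jointPot (if p then l else true) (if !p then r else true) true a true c o' +
      ((!l).toNat + (!r).toNat + (!d).toNat) ≤ jointPot l r a b c d o + 5 * (!o).toNat := by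
  decide

theorem jointPot_snd : ∀ p q l r a b c d : Bool, compatible p q l r a b c d →
    ∀ o o' : Bool, (o' → o) →
    jointPot (if q then l else false) (if !q then r else false) false false a b o' +
      (l.toNat + r.toNat + d.toNat) ≤ jointPot l r a b c d o + 5 * o.toNat := by
  decide

end Pairs

/-! ### How the lists of the three candidates evolve -/

section Algorithms

variable {α : Type*} [DecidableEq α]

/-- A rule that leaves a requested item `x` where it is if `q h x`, and moves it to the front
otherwise, where `q h x` alternates with the requests to `x`. -/
structure IsAlternating (R : Rule α) (q : List α → α → Bool) : Prop where
  rule_eq : ∀ h L x, R h L x = if q h x then L.idxOf x else 0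
  cons_self : ∀ h x, q (x :: h) x = !q h x
  cons_of_ne : ∀ h x y, y ≠ x → q (x :: h) y = q h y

/-- Whether the number of requests to `x` is odd. -/
def oddCount (h : List α) (x : α) : Bool := !decide (Even (h.count x))

theorem mtfo_isAlternating : IsAlternating (α := α) mtfo oddCount where
  rule_eq h L x := by by_cases hx : Even (h.count x) <;> simp [mtfo, oddCount, hx]
  cons_self h x := by simp [oddCount, Nat.even_add_one, -Nat.not_even_iff_odd]
  cons_of_ne h x y hy := by simp [oddCount, List.count_cons_of_ne hy.symm]

theorem mtfe_isAlternating : IsAlternating (α := α) mtfe (fun h x => !oddCount h x) where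
  rule_eq h L x := by
    by_cases hx : Even (h.count x) <;> simp [mtfe, oddCount, hx, ← Nat.not_even_iff_odd]
  cons_self h x := by simp [oddCount, Nat.even_add_one, -Nat.not_even_iff_odd]
  cons_of_ne h x y hy := by simp [oddCount, List.count_cons_of_ne hy.symm]

variable {R : Rule α} {q : List α → α → Bool}

theorem IsAlternating.le_idxOf (hR : IsAlternating R q) (h L : List α) (x : α) :
    R h L x ≤ L.idxOf x := by
  rw [hR.rule_eq]; split_ifs <;> simp

theorem IsAlternating.before_right (hR : IsAlternating R q) {L : List α} (hL : IsListing L)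
    (h : List α) {x y : α} (hy : y ≠ x) :
    before (moveTo L x (R h L x)) y x = if q h x then before L y x else false := by
  rw [before_moveTo_self hL (hR.le_idxOf h L x) hy, hR.rule_eq, before]
  split_ifs <;> simp

theorem IsAlternating.before_left (hR : IsAlternating R q) {L : List α} (hL : IsListing L)
    (h : List α) {x y : α} (hy : y ≠ x) :
    before (moveTo L x (R h L x)) x y = if q h x then before L x y else true := by
  rw [(hL.moveTo (hR.le_idxOf h L x)).before_swap hy, hR.before_right hL h hy,
    hL.before_swap hy.symm]
  split_ifs <;> simp

/-- How recent the last request `f x` and the second last request `s x` to every item `x` are, where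
the requests `h` (most recent first) are preceded by two fictitious requests to every item. In the
list of Timestamp, the items are sorted by `s`. -/
structure Recency (h L : List α) (f s : α → ℕ) : Prop where
  last_ne : ∀ x y, x ≠ y → f x ≠ f y
  second_ne : ∀ x y, x ≠ y → s x ≠ s y
  last_ne_second : ∀ x y, f x ≠ s y
  last_lt_second : ∀ x, f x < s x
  before_eq : ∀ x y, x ≠ y → before L x y = decide (s x < s y)
  fresh : ∀ x, x ∉ h → s x = f x + 1
  count_eq_zero : ∀ x ∈ h, ∀ y, y ≠ x →
    ((h.takeWhile (fun z => decide (z ≠ x))).count y = 0 ↔ f x < f y)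
  count_le_one : ∀ x ∈ h, ∀ y, y ≠ x →
    ((h.takeWhile (fun z => decide (z ≠ x))).count y ≤ 1 ↔ f x < s y)

/-- The update of the last requests on a request to `x`. -/
def nextLast (f : α → ℕ) (x : α) : α → ℕ := fun z => if z = x then 0 else f z + 1

/-- The update of the second last requests on a request to `x`. -/
def nextSecond (f s : α → ℕ) (x : α) : α → ℕ := fun z => if z = x then f x + 1 else s z + 1

theorem timestamp_le_idxOf (h L : List α) (x : α) :
    timestamp h L x ≤ L.idxOf x := by
  rw [timestamp]
  split_ifs
  · by_contra hlt
    push Not at hlt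
    have h1 := List.not_of_lt_findIdx hlt
    rw [List.getElem_idxOf] at h1
    have h2 : (h.takeWhile (fun z => decide (z ≠ x))).count x = 0 :=
      List.count_eq_zero.2 fun hm => by simpa using List.mem_takeWhile_imp hm
    rw [h2] at h1
    simp at h1
  · rfl

/-- The fictitious past requests every item twice in succession, from the back of the list to the
front. Two requests leave parities unchanged. -/
theorem Recency.start {L : List α} (hL : IsListing L) :
    Recency [] L (fun x => 2 * L.idxOf x) (fun x => 2 * L.idxOf x + 1) where
  last_ne x y hxy := by have := hL.idxOf_ne hxy; omega
  second_ne x y hxy := by have := hL.idxOf_ne hxy; omega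
  last_ne_second x y := by omega
  last_lt_second x := by omega
  before_eq x y _ := by rw [before, decide_eq_decide]; omega
  fresh x _ := rfl
  count_eq_zero x hx := by simp at hx
  count_le_one x hx := by simp at hx

variable {h L : List α} {f s : α → ℕ}

/-- The items requested at least twice since the last request to `x` are those with `s y < f x`. As
the list is sorted by `s`, they form a prefix, and `x` is inserted right behind it. For a first
request, `fresh` makes staying put agree with this. -/
theorem Recency.before_timestamp (hr : Recency h L f s) (hL : IsListing L) {x y : α}
    (hy : y ≠ x) : before (moveTo L x (timestamp h L x)) y x = decide (s y < f x) := by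
  have hle := timestamp_le_idxOf h L x
  have hlt : ∀ a b, a ≠ b → (L.idxOf a < L.idxOf b ↔ s a < s b) := fun a b hab => by
    simpa [before] using hr.before_eq a b hab
  rw [before_moveTo_self hL hle hy, decide_eq_decide]
  by_cases hx : x ∈ h
  · have hp : timestamp h L x = L.findIdx
        (fun y => decide ((h.takeWhile (fun z => decide (z ≠ x))).count y ≤ 1)) := if_pos hx
    constructor
    · intro hi
      rw [hp] at hi
      have h1 := List.not_of_lt_findIdx hi
      rw [List.getElem_idxOf] at h1
      rw [decide_eq_false_iff_not, hr.count_le_one x hx y hy] at h1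
      have := hr.last_ne_second x y
      omega
    · intro hs
      -- `w` is the item found at the insertion index. It passes the test, so `f x < s w`, and
      -- sortedness puts `y` in front of it.
      by_contra hi
      push Not at hi
      have hlen : timestamp h L x < L.length := hle.trans_lt (hL.idxOf_lt x)
      obtain ⟨w, hw⟩ : ∃ w, w = L[timestamp h L x] := ⟨_, rfl⟩
      have hwi : L.idxOf w = timestamp h L x := by rw [hw]; exact hL.nodup.idxOf_getElem _ hlen
      have hpw : (h.takeWhile (fun z => decide (z ≠ x))).count w ≤ 1 := by
        rw [hw]
        simp only [hp]
        rw [hp] at hlen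
        simpa using List.findIdx_getElem (w := hlen)
      have h3 := hr.last_lt_second x
      have hsw : f x < s w := by
        by_cases hwx : w = x
        · rw [hwx]; exact h3
        · exact (hr.count_le_one x hx w hwx).1 hpw
      have hyw : y ≠ w := by rintro rfl; omega
      have := (hlt y w hyw).2 (by omega)
      omega
  · have hp : timestamp h L x = L.idxOf x := if_neg hx
    rw [hp, hlt y x hy, hr.fresh x hx]
    have := hr.last_ne_second x y
    omega

theorem Recency.step (hr : Recency h L f s) (hL : IsListing L) (x : α) :
    Recency (x :: h) (moveTo L x (timestamp h L x)) (nextLast f x) (nextSecond f s x) := by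
  have hle := timestamp_le_idxOf h L x
  refine ⟨?_, ?_, ?_, ?_, ?_, ?_, ?_, ?_⟩
  · intro y z hyz
    have := hr.last_ne y z hyz
    simp only [nextLast]; split_ifs <;> grind
  · intro y z hyz
    have := hr.second_ne y z hyz
    have h1 := hr.last_ne_second y z
    have h2 := hr.last_ne_second z y
    simp only [nextSecond]; split_ifs <;> grind
  · intro y z
    have h1 := hr.last_ne_second y z
    have h2 := hr.last_ne y z
    simp only [nextSecond, nextLast]; split_ifs <;> grind
  · intro y
    have h1 := hr.last_lt_second y
    simp only [nextSecond, nextLast]; split_ifs <;> grind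
  · intro y z hyz
    by_cases hy : y = x
    · subst hy
      rw [(hL.moveTo hle).before_swap hyz.symm, hr.before_timestamp hL hyz.symm, ← decide_not,
        decide_eq_decide]
      have := hr.last_ne_second y z
      simp only [nextSecond, if_pos, if_neg hyz.symm]
      omega
    · by_cases hz : z = x
      · subst hz
        rw [hr.before_timestamp hL hyz, decide_eq_decide]
        simp only [nextSecond, if_pos, if_neg hyz]
        omega
      · rw [before_moveTo_of_ne hL hle hy hz, hr.before_eq y z hyz, decide_eq_decide]
        simp only [nextSecond, if_neg hy, if_neg hz]
        omega
  · intro y hy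
    rw [List.mem_cons, not_or] at hy
    simp [nextSecond, nextLast, hy.1, hr.fresh y hy.2]
  · intro y hy z hz
    by_cases hyx : y = x
    · subst hyx
      simp [nextLast, hz]
    · have hyh : y ∈ h := (List.mem_cons.1 hy).resolve_left hyx
      have h1 := hr.count_eq_zero y hyh z hz
      by_cases hzx : z = x
      · subst hzx
        simp [nextLast, hz]
      · simpa [nextLast, List.takeWhile_cons, hz, hzx, hyx, Ne.symm hyx, Ne.symm hzx] using h1
  · intro y hy z hz
    by_cases hyx : y = x
    · subst hyx
      simp [nextLast, nextSecond, hz]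
    · have hyh : y ∈ h := (List.mem_cons.1 hy).resolve_left hyx
      by_cases hzx : z = x
      · subst hzx
        -- The new request counts once, so at most one request now means none before;
        -- `count_eq_zero` is carried along for this case.
        have h1 := hr.count_eq_zero y hyh z hz
        simpa [nextLast, nextSecond, List.takeWhile_cons, hz, hyx] using h1
      · have h1 := hr.count_le_one y hyh z hz
        simpa [nextLast, nextSecond, List.takeWhile_cons, hz, hzx, hyx, Ne.symm hyx, Ne.symm hzx]
          using h1

end Algorithms

/-! ### Competitive ratios of the single algorithms and of the three candidates jointly -/

section Competitive

variable {α : Type*} [DecidableEq α]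

/-- The four truth values that describe the interleaving of two items, computed from a comparison of the recency of requests. -/
def recencyBits {β : Type*} (f s : α → ℕ) (F : Bool → Bool → Bool → Bool → β) (x y : α) : β :=
  F (decide (f x < f y)) (decide (s x < f y)) (decide (f x < s y)) (decide (s x < s y))

theorem recencyBits_of_ne {β : Type*} (f s : α → ℕ) (F : Bool → Bool → Bool → Bool → β)
    {x y z : α} (hy : y ≠ x) (hz : z ≠ x) :
    recencyBits (nextLast f x) (nextSecond f s x) F y z = recencyBits f s F y z := by
  simp [recencyBits, nextLast, nextSecond, hy, hz]

theorem recencyBits_left {β : Type*} (f s : α → ℕ) (F : Bool → Bool → Bool → Bool → β)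
    {x y : α} (hy : y ≠ x) :
    recencyBits (nextLast f x) (nextSecond f s x) F x y =
      F true (decide (f x < f y)) true (decide (f x < s y)) := by
  simp [recencyBits, nextLast, nextSecond, hy]

theorem Recency.bits_right {β : Type*} {h L : List α} {f s : α → ℕ} (hr : Recency h L f s)
    (F : Bool → Bool → Bool → Bool → β) {x y : α} (hy : y ≠ x) :
    recencyBits (nextLast f x) (nextSecond f s x) F y x =
      F false false (decide (f y < f x)) (decide (s y < f x)) := by
  have h1 := hr.last_ne_second x y
  simp [recencyBits, nextLast, nextSecond, hy]

theorem Recency.interleaved {h L : List α} {f s : α → ℕ} (hr : Recency h L f s) (x y : α) :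
    recencyBits f s interleaved x y = true := by
  have h1 := hr.last_lt_second x
  have h2 := hr.last_lt_second y
  simp only [recencyBits, ListUpdate.interleaved, Bool.and_eq_true, Bool.or_eq_true,
    Bool.not_eq_true', decide_eq_true_eq, decide_eq_false_iff_not]
  omega

variable [Fintype α]

/-- The potential of Move-To-Front with list `L` against an adversary with list `L'`. -/
def mtfPotential (L L' : List α) : ℕ := pairSum (fun x y o => mtfPot (before L x y) o) L'

theorem mtfPotential_le (L L' : List α) : mtfPotential L L' ≤ 2 * Fintype.card α ^ 2 :=
  pairSum_le (fun _ _ _ _ => mtfPot_le _ _) L'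

/-- Move-To-Front pays at most twice as much as the adversary, in the amortized sense. -/
theorem mtf_step {L L₀ L' : List α} {x : α} {k i : ℕ} (hL : IsListing L) (hL₀ : IsListing L₀)
    (hex : Exchanges k L₀ L') (hi : i ≤ L'.idxOf x) :
    2 * accessCost L x + mtfPotential (moveTo L x 0) (moveTo L' x i) ≤
      4 * (k + accessCost L' x) + mtfPotential L L₀ := by
  have h := pairSum_step (G := fun x y o => mtfPot (before L x y) o)
    (G' := fun y z o => mtfPot (before (moveTo L x 0) y z) o) (A := fun y => (before L y x).toNat)
    hL₀ hex hi (fun _ _ _ _ => mtfPot_le _ _)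
    (fun y z o hy hz _ => by rw [before_moveTo_of_ne hL (Nat.zero_le _) hy hz])
    (fun y hy o o' ho => by
      rw [moveTo_before_of_ne hL (Nat.zero_le _) hy, hL.before_swap hy.symm]
      simpa using mtfPot_fst _ o o' ho)
    (fun y hy o o' ho => by
      rw [before_moveTo_self hL (Nat.zero_le _) hy]
      simpa using mtfPot_snd _ o o' ho)
  rw [← hL.idxOf_eq_sum] at h
  rw [mtfPotential, mtfPotential, accessCost]
  linarith

/-- The potential of an alternating rule with list `L` against an adversary with list `L'`. -/
def alternatingPotential (q : α → Bool) (L L' : List α) : ℕ :=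
  pairSum (fun x y o => alternatingPot (q x) (q y) (before L x y) o) L'

theorem alternatingPotential_le (q : α → Bool) (L L' : List α) :
    alternatingPotential q L L' ≤ 5 * Fintype.card α ^ 2 :=
  pairSum_le (fun _ _ _ _ => alternatingPot_le _ _ _ _) L'

/-- An alternating rule pays at most `5 / 2` times as much as the adversary, in the amortized
sense. -/
theorem IsAlternating.step {R : Rule α} {q : List α → α → Bool} (hR : IsAlternating R q)
    {h L L₀ L' : List α} {x : α} {k i : ℕ} (hL : IsListing L) (hL₀ : IsListing L₀)
    (hex : Exchanges k L₀ L') (hi : i ≤ L'.idxOf x) :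
    4 * accessCost L x +
        alternatingPotential (q (x :: h)) (moveTo L x (R h L x)) (moveTo L' x i) ≤
      10 * (k + accessCost L' x) + alternatingPotential (q h) L L₀ := by
  have h := pairSum_step (G := fun x y o => alternatingPot (q h x) (q h y) (before L x y) o)
    (G' := fun y z o => alternatingPot (q (x :: h) y) (q (x :: h) z)
      (before (moveTo L x (R h L x)) y z) o)
    (A := fun y => 2 * (before L y x).toNat)
    hL₀ hex hi (fun _ _ _ _ => alternatingPot_le _ _ _ _)
    (fun y z o hy hz _ => by
      rw [before_moveTo_of_ne hL (hR.le_idxOf h L x) hy hz, hR.cons_of_ne _ _ _ hy,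
        hR.cons_of_ne _ _ _ hz])
    (fun y hy o o' ho => by
      rw [hR.before_left hL h hy, hL.before_swap hy.symm, hR.cons_self, hR.cons_of_ne _ _ _ hy]
      exact alternatingPot_fst _ _ _ o o' ho)
    (fun y hy o o' ho => by
      rw [hR.before_right hL h hy, hR.cons_self, hR.cons_of_ne _ _ _ hy]
      exact alternatingPot_snd _ _ _ o o' ho)
  rw [← Finset.mul_sum, ← hL.idxOf_eq_sum] at h
  rw [alternatingPotential, alternatingPotential, accessCost]
  linarith

/-- Both sides are doubled because `pairSum` counts every pair in both orders. -/
theorem timestamp_bound {h L L' σ : List α} {f s : α → ℕ} {c : ℕ} (hr : Recency h L f s)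
    (hL : IsListing L) (hL' : IsListing L') (hs : Serves L' σ c) :
    2 * ruleCost timestamp h L σ ≤ 4 * c + pairSum (recencyBits f s timestampPot) L' := by
  induction σ generalizing h L L' f s c with
  | nil => simp [ruleCost]
  | cons x σ ih =>
    obtain ⟨k, L'', i, c', hex, hi, hs', rfl⟩ := hs.exists_access
    have hL'' := hL'.perm hex.perm
    have hstep := hr.step hL x
    have h1 := ih hstep (hL.moveTo (timestamp_le_idxOf h L x)) (hL''.moveTo hi) hs'
    have h2 := pairSum_step (G := recencyBits f s timestampPot)
      (G' := recencyBits (nextLast f x) (nextSecond f s x) timestampPot)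
      (A := fun y => (before L y x).toNat) hL' hex hi
      (fun _ _ _ _ => timestampPot_le _ _ _ _ _)
      (fun y z o hy hz _ => by rw [recencyBits_of_ne f s _ hy hz])
      (fun y hy o o' ho => by
        rw [recencyBits_left f s _ hy, hL.before_swap hy.symm, hr.before_eq x y hy.symm]
        exact timestampPot_fst _ _ _ _ (hr.interleaved x y) o o' ho)
      (fun y hy o o' ho => by
        rw [hr.bits_right _ hy, hr.before_eq y x hy]
        exact timestampPot_snd _ _ _ _ (hr.interleaved y x) o o' ho)
    rw [← hL.idxOf_eq_sum] at h2
    rw [ruleCost, accessCost]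
    linarith

/-- Timestamp is `2`-competitive. -/
theorem timestamp_competitive {L σ : List α} {c : ℕ} (hL : IsListing L) (hs : Serves L σ c) :
    ruleCost timestamp [] L σ ≤ 2 * c + Fintype.card α ^ 2 := by
  have h1 := timestamp_bound (Recency.start hL) hL hL hs
  have h2 := pairSum_le (G := recencyBits (fun x => 2 * L.idxOf x) (fun x => 2 * L.idxOf x + 1)
    timestampPot) (fun _ _ _ _ => timestampPot_le _ _ _ _ _) L
  omega

theorem joint_bound {h L₁ L₂ L₃ L' σ : List α} {f s : α → ℕ} {c : ℕ} (hr : Recency h L₃ f s)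
    (hL₁ : IsListing L₁) (hL₂ : IsListing L₂) (hL₃ : IsListing L₃) (hL' : IsListing L')
    (hc : ∀ x y, x ≠ y → recencyBits f s (compatible (oddCount h x) (oddCount h y)
      (before L₁ x y) (before L₂ x y)) x y = true)
    (hs : Serves L' σ c) :
    2 * (ruleCost mtfo h L₁ σ + ruleCost mtfe h L₂ σ + ruleCost timestamp h L₃ σ) ≤
      10 * c + pairSum (fun x y => recencyBits f s
        (jointPot (before L₁ x y) (before L₂ x y)) x y) L' := by
  induction σ generalizing h L₁ L₂ L₃ L' f s c with
  | nil => simp [ruleCost]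
  | cons x σ ih =>
    obtain ⟨k, L'', i, c', hex, hi, hs', rfl⟩ := hs.exists_access
    have hL'' := hL'.perm hex.perm
    have hstep := hr.step hL₃ x
    have h₁ := mtfo_isAlternating (α := α)
    have h₂ := mtfe_isAlternating (α := α)
    have hle₁ := h₁.le_idxOf h L₁ x
    have hle₂ := h₂.le_idxOf h L₂ x
    have h1 := ih hstep (hL₁.moveTo hle₁) (hL₂.moveTo hle₂)
      (hL₃.moveTo (timestamp_le_idxOf h L₃ x)) (hL''.moveTo hi)
      (fun y z hyz => by
        by_cases hy : y = x
        · subst hy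
          rw [recencyBits_left f s _ hyz.symm, h₁.before_left hL₁ h hyz.symm,
            h₂.before_left hL₂ h hyz.symm, h₁.cons_self, h₁.cons_of_ne _ _ _ hyz.symm]
          exact compatible_fst _ _ _ _ _ _ _ _ (hc y z hyz)
        · by_cases hz : z = x
          · subst hz
            rw [hr.bits_right _ hyz, h₁.before_right hL₁ h hyz,
              h₂.before_right hL₂ h hyz, h₁.cons_self, h₁.cons_of_ne _ _ _ hyz]
            exact compatible_snd _ _ _ _ _ _ _ _ (hc y z hyz)
          · rw [recencyBits_of_ne f s _ hy hz, before_moveTo_of_ne hL₁ hle₁ hy hz,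
              before_moveTo_of_ne hL₂ hle₂ hy hz, h₁.cons_of_ne _ _ _ hy, h₁.cons_of_ne _ _ _ hz]
            exact hc y z hyz) hs'
    have h2 := pairSum_step
      (G := fun x y => recencyBits f s (jointPot (before L₁ x y) (before L₂ x y)) x y)
      (G' := fun y z => recencyBits (nextLast f x) (nextSecond f s x)
        (jointPot (before (moveTo L₁ x (mtfo h L₁ x)) y z)
          (before (moveTo L₂ x (mtfe h L₂ x)) y z)) y z)
      (A := fun y => (before L₁ y x).toNat + (before L₂ y x).toNat + (before L₃ y x).toNat)
      hL' hex hi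
      (fun _ _ _ _ => jointPot_le _ _ _ _ _ _ _)
      (fun y z o hy hz _ => by
        rw [recencyBits_of_ne f s _ hy hz, before_moveTo_of_ne hL₁ hle₁ hy hz,
          before_moveTo_of_ne hL₂ hle₂ hy hz])
      (fun y hy o o' ho => by
        rw [recencyBits_left f s _ hy, hL₁.before_swap hy.symm, hL₂.before_swap hy.symm,
          hL₃.before_swap hy.symm, hr.before_eq x y hy.symm, h₁.before_left hL₁ h hy,
          h₂.before_left hL₂ h hy]
        exact jointPot_fst _ _ _ _ _ _ _ _ (hc x y hy.symm) o o' ho)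
      (fun y hy o o' ho => by
        rw [hr.bits_right _ hy, hr.before_eq y x hy, h₁.before_right hL₁ h hy,
          h₂.before_right hL₂ h hy]
        exact jointPot_snd _ _ _ _ _ _ _ _ (hc y x hy) o o' ho)
    rw [Finset.sum_add_distrib, Finset.sum_add_distrib, ← hL₁.idxOf_eq_sum, ← hL₂.idxOf_eq_sum,
      ← hL₃.idxOf_eq_sum] at h2
    simp only [ruleCost, accessCost] at h1 h2 ⊢
    linarith

/-- The costs of MTFO, MTFE and Timestamp add up to at most five times the cost of any way of serving
the requests, up to an additive constant. -/
theorem joint_competitive {L σ : List α} {c : ℕ} (hL : IsListing L) (hs : Serves L σ c) :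
    2 * (ruleCost mtfo [] L σ + ruleCost mtfe [] L σ + ruleCost timestamp [] L σ) ≤
      10 * c + 5 * Fintype.card α ^ 2 := by
  refine (joint_bound (Recency.start hL) hL hL hL hL (fun x y hxy => ?_) hs).trans
    (Nat.add_le_add_left (pairSum_le (fun _ _ _ _ => jointPot_le _ _ _ _ _ _ _) L) _)
  -- In the fictitious past both requests to the item in front are newer than those to the other
  -- item, and all lists agree.
  rcases (hL.idxOf_ne hxy).lt_or_gt with h | h
  · have h1 : 2 * L.idxOf x + 1 < 2 * L.idxOf y := by omega
    have h2 : 2 * L.idxOf x < 2 * L.idxOf y + 1 := by omega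
    simp [recencyBits, before, compatible, interleaved, h, h1, h2]
  · have h1 : ¬ 2 * L.idxOf x + 1 < 2 * L.idxOf y := by omega
    have h2 : ¬ 2 * L.idxOf x < 2 * L.idxOf y + 1 := by omega
    simp [recencyBits, before, compatible, interleaved, h.le, h1, h2]

end Competitive

/-! ### Amortization over trusting and ignoring phases -/

section Phases

variable {α : Type*} [DecidableEq α] [Fintype α]

theorem IsListing.accessCost_le {L : List α} (hL : IsListing L) (x : α) :
    accessCost L x ≤ Fintype.card α := by
  rw [← hL.length_eq_card]
  exact hL.idxOf_lt x

/-- The states of the phased algorithm that occur on lists of length `m`. -/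
structure TogState.Valid (m : ℕ) (β : ℝ) (s : TogState α) : Prop where
  simulated : IsListing s.simulated
  current : IsListing s.current
  eq_of_trusting : s.trusting = true → s.current = s.simulated
  trusting_le : s.trusting = true → (s.phaseCost : ℝ) ≤ (m : ℝ) ^ 3 + m
  ignoring_le : s.trusting = false → (s.phaseCost : ℝ) ≤ β * (m : ℝ) ^ 3 + m

/-- The potential of the phased algorithm, when `Φ` is a potential for trusting phases and `L'` is the
list of the adversary. -/
noncomputable def TogState.potential (m : ℕ) (a₁ a₂ : ℝ) (Φ : List α → List α → List α → ℝ)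
    (s : TogState α) (L' : List α) : ℝ :=
  if s.trusting = true then a₂ * Φ s.history s.simulated L' - (1 - a₂) * s.phaseCost
  else a₁ * (mtfPotential s.current L' / 2) - (1 - a₁) * s.phaseCost
    - (a₁ * (m : ℝ) ^ 2 + (1 - a₂) * (m : ℝ) ^ 3 + |1 - a₂| * m)

variable {m : ℕ} {β a₁ a₂ B : ℝ} {Φ : List α → List α → List α → ℝ} {s : TogState α}
  {L' : List α}

theorem mtfPotential_half_le (hm : Fintype.card α = m) (L L' : List α) :
    (mtfPotential L L' : ℝ) / 2 ≤ (m : ℝ) ^ 2 := by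
  have h : (mtfPotential L L' : ℝ) ≤ 2 * (m : ℝ) ^ 2 := by
    rw [← hm]; exact_mod_cast mtfPotential_le L L'
  linarith

/-- The constant subtracted during an ignoring phase is fixed here: `a₁ * m ^ 2` covers the initial
potential of Move-To-Front, `(1 - a₂) * m ^ 3` carries over the balance of the trusting phase, and
`|1 - a₂| * m` covers the overshoot by the last access. Absolute values appear because either kind
of phase may run at a loss. -/
theorem TogState.potential_endTrusting (hm : Fintype.card α = m) (hβ : 0 ≤ β) (ha₁ : 0 ≤ a₁)
    (ha₂ : 0 ≤ a₂) (hΦ : ∀ h S L', 0 ≤ Φ h S L') (hs : s.Valid m β) :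
    (s.endTrusting m).Valid m β ∧
      (s.endTrusting m).potential m a₁ a₂ Φ L' ≤ s.potential m a₁ a₂ Φ L' ∧
      ((s.endTrusting m).trusting = true → ((s.endTrusting m).phaseCost : ℝ) ≤ (m : ℝ) ^ 3) := by
  by_cases h : s.trusting = true ∧ m ^ 3 ≤ s.phaseCost
  · have e : s.endTrusting m = { s with trusting := false, phaseCost := 0 } := if_pos h
    rw [e]
    refine ⟨⟨hs.simulated, hs.current, by simp, by simp, fun _ => by simp; positivity⟩, ?_,
      by simp⟩
    have h1 : (m : ℝ) ^ 3 ≤ s.phaseCost := by exact_mod_cast h.2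
    have h2 := hs.trusting_le h.1
    have h3 : (1 - a₂) * (s.phaseCost - (m : ℝ) ^ 3) ≤ |1 - a₂| * m := by
      refine (le_abs_self _).trans ?_
      rw [abs_mul, abs_of_nonneg (sub_nonneg.2 h1)]
      exact mul_le_mul_of_nonneg_left (by linarith) (abs_nonneg _)
    have h4 := mul_le_mul_of_nonneg_left (mtfPotential_half_le hm s.current L') ha₁
    have h5 := mul_nonneg ha₂ (hΦ s.history s.simulated L')
    simp only [TogState.potential, h.1, if_true, Bool.false_eq_true, if_false, Nat.cast_zero]
    linarith
  · have e : s.endTrusting m = s := if_neg h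
    rw [e]
    refine ⟨hs, le_rfl, fun ht => ?_⟩
    have : s.phaseCost ≤ m ^ 3 := by
      by_contra hlt
      exact h ⟨ht, by omega⟩
    exact_mod_cast this

/-- A full round leaves a surplus of `((a₁ - 1) * β + (a₂ - 1)) * m ^ 3`. By `hD` it pays for the
list change, for restarting both potentials and for the overshoots. -/
theorem TogState.potential_endIgnoring (hm : Fintype.card α = m) (ha₁ : 0 ≤ a₁)
    (ha₂ : 0 ≤ a₂) (hΦ : ∀ h S L', Φ h S L' ≤ B * (m : ℝ) ^ 2)
    (hD : a₁ * (m : ℝ) ^ 2 + a₂ * (B * (m : ℝ) ^ 2) + (m : ℝ) ^ 2 + |1 - a₁| * m + |1 - a₂| * m ≤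
      ((a₁ - 1) * β + (a₂ - 1)) * (m : ℝ) ^ 3)
    (hs : s.Valid m β) (ht : s.trusting = true → (s.phaseCost : ℝ) ≤ (m : ℝ) ^ 3) :
    (s.endIgnoring m β).Valid m β ∧
      s.paidCost m β + (s.endIgnoring m β).potential m a₁ a₂ Φ L' ≤ s.potential m a₁ a₂ Φ L' ∧
      ((s.endIgnoring m β).trusting = true →
        ((s.endIgnoring m β).phaseCost : ℝ) ≤ (m : ℝ) ^ 3) ∧
      ((s.endIgnoring m β).trusting = false →
        ((s.endIgnoring m β).phaseCost : ℝ) ≤ β * (m : ℝ) ^ 3) := by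
  by_cases h : s.IgnoringOver m β
  · have e : s.endIgnoring m β =
        { s with current := s.simulated, trusting := true, phaseCost := 0 } := if_pos h
    have e' : s.paidCost m β = exchangeCost s.current s.simulated := if_pos h
    rw [e, e']
    refine ⟨⟨hs.simulated, hs.simulated, by simp, fun _ => by simp; positivity, by simp⟩, ?_,
      fun _ => by simp, by simp⟩
    have h1 := h.2
    have h2 := hs.ignoring_le h.1
    have h3 : (1 - a₁) * (s.phaseCost - β * (m : ℝ) ^ 3) ≤ |1 - a₁| * m := by
      refine (le_abs_self _).trans ?_
      rw [abs_mul, abs_of_nonneg (sub_nonneg.2 h1)]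
      exact mul_le_mul_of_nonneg_left (by linarith) (abs_nonneg _)
    have h4 : (0 : ℝ) ≤ a₁ * (mtfPotential s.current L' / 2) := by positivity
    have h5 := mul_le_mul_of_nonneg_left (hΦ s.history s.simulated L') ha₂
    have hperm : s.current.Perm s.simulated :=
      (List.perm_ext_iff_of_nodup hs.current.nodup hs.simulated.nodup).2 fun x =>
        ⟨fun _ => hs.simulated.complete x, fun _ => hs.current.complete x⟩
    have h6 : (exchangeCost s.current s.simulated : ℝ) ≤ (m : ℝ) ^ 2 := by
      have := exchangeCost_le hperm
      rw [hs.current.length_eq_card, hm] at this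
      exact_mod_cast this
    simp only [TogState.potential, h.1, if_true, Bool.false_eq_true, if_false, Nat.cast_zero]
    linarith
  · have e : s.endIgnoring m β = s := if_neg h
    have e' : s.paidCost m β = 0 := if_neg h
    rw [e, e']
    refine ⟨hs, by simp, ht, fun hf => ?_⟩
    by_contra hlt
    exact h ⟨hf, (not_le.1 hlt).le⟩

/-- Scaling by `w / 2` and `w / κ` makes both kinds of phase charge the adversary exactly `w * c₀`.
The part of the scaled access cost beyond the real one is stored through `phaseCost`. -/
theorem TogState.potential_serve {R : Rule α} {κ w c₀ : ℝ} {L'' : List α} {x : α}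
    (hm : Fintype.card α = m) (hR : ∀ h L x, R h L x ≤ L.idxOf x) (hκ : 0 < κ) (hw : 0 ≤ w)
    (hs : s.Valid m β) (ht : s.trusting = true → (s.phaseCost : ℝ) ≤ (m : ℝ) ^ 3)
    (hi : s.trusting = false → (s.phaseCost : ℝ) ≤ β * (m : ℝ) ^ 3)
    (hmtf : ∀ L, IsListing L →
      2 * (accessCost L x : ℝ) + mtfPotential (moveTo L x 0) L'' ≤ 4 * c₀ + mtfPotential L L')
    (hΦ : (accessCost s.simulated x : ℝ) +
        Φ (x :: s.history) (moveTo s.simulated x (R s.history s.simulated x)) L'' ≤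
      κ * c₀ + Φ s.history s.simulated L') :
    (s.serve R x).Valid m β ∧
      accessCost s.current x + (s.serve R x).potential m (w / 2) (w / κ) Φ L'' ≤
        w * c₀ + s.potential m (w / 2) (w / κ) Φ L' := by
  have hacc : (accessCost s.current x : ℝ) ≤ m := by
    rw [← hm]; exact_mod_cast hs.current.accessCost_le x
  rcases hb : s.trusting with _ | _
  · refine ⟨⟨hs.simulated.moveTo (hR _ _ _), ?_, ?_, ?_, ?_⟩, ?_⟩
    · simpa [TogState.serve, hb, mtf] using hs.current.moveTo (Nat.zero_le _)
    · simp [TogState.serve, hb]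
    · simp [TogState.serve, hb]
    · intro _
      have := hi hb
      simp only [TogState.serve, Nat.cast_add]
      linarith
    · have h1 := mul_le_mul_of_nonneg_left (hmtf s.current hs.current) (by positivity : 0 ≤ w / 4)
      simp only [TogState.potential, TogState.serve, hb, Bool.false_eq_true, if_false, mtf,
        Nat.cast_add]
      linarith
  · have hcur := hs.eq_of_trusting hb
    refine ⟨⟨hs.simulated.moveTo (hR _ _ _), ?_, ?_, ?_, ?_⟩, ?_⟩
    · simpa [TogState.serve, hb] using hs.current.moveTo (hR _ _ _)
    · simp [TogState.serve, hb, hcur]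
    · intro _
      have := ht hb
      simp only [TogState.serve, Nat.cast_add]
      linarith
    · simp [TogState.serve, hb]
    · have h1 := mul_le_mul_of_nonneg_left hΦ (by positivity : 0 ≤ w / κ)
      have h2 : w / κ * (κ * c₀ + Φ s.history s.simulated L') =
          w * c₀ + w / κ * Φ s.history s.simulated L' := by field_simp
      rw [h2] at h1
      simp only [TogState.potential, TogState.serve, hb, if_true, Nat.cast_add, hcur]
      linarith

theorem TogState.neg_potential_le (ha₁ : 0 ≤ a₁) (ha₂ : 0 ≤ a₂) (hβ : 0 ≤ β)
    (hΦ : ∀ h S L', 0 ≤ Φ h S L') (hs : s.Valid m β) :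
    -s.potential m a₁ a₂ Φ L' ≤ |1 - a₂| * ((m : ℝ) ^ 3 + m) +
      |1 - a₁| * (β * (m : ℝ) ^ 3 + m) + a₁ * (m : ℝ) ^ 2 := by
  have h4 : (0 : ℝ) ≤ a₁ * (mtfPotential s.current L' / 2) := by positivity
  have h5 := mul_nonneg ha₂ (hΦ s.history s.simulated L')
  have h0 : 0 ≤ a₁ * (m : ℝ) ^ 2 := by positivity
  have h1 : 0 ≤ |1 - a₁| * (β * (m : ℝ) ^ 3 + m) := by positivity
  have key : ∀ a p q : ℝ, 0 ≤ p → p ≤ q → a * p ≤ |a| * q := fun a p q hp hpq =>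
    (mul_le_mul_of_nonneg_right (le_abs_self a) hp).trans
      (mul_le_mul_of_nonneg_left hpq (abs_nonneg a))
  rcases hb : s.trusting with _ | _
  · have h2 := key (1 - a₁) _ _ (Nat.cast_nonneg _) (hs.ignoring_le hb)
    have h3 := key (1 - a₂) ((m : ℝ) ^ 3) _ (by positivity) le_rfl
    simp only [TogState.potential, hb, Bool.false_eq_true, if_false]
    linarith
  · have h2 := key (1 - a₂) _ _ (Nat.cast_nonneg _) (hs.trusting_le hb)
    simp only [TogState.potential, hb, if_true]
    linarith

/-- The amortized analysis of toggling against an adversary: `Adv h S L' σ c` says that the adversary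
with list `L'` can serve `σ` at cost `c`, when `h` are the past requests and `S` is the list of the
rule `R`. If Move-To-Front pays at most twice and `R` pays at most `κ` times as much as the adversary,
in the amortized sense, then toggling pays at most `w` times as much. -/
theorem toggleCost_le {R : Rule α} {κ w : ℝ} (hm : Fintype.card α = m)
    (hR : ∀ h L x, R h L x ≤ L.idxOf x) (hκ : 0 < κ) (hw : 0 ≤ w) (hβ : 0 ≤ β)
    (Adv : List α → List α → List α → List α → ℕ → Prop)
    (hΦ₀ : ∀ h S L', 0 ≤ Φ h S L') (hΦB : ∀ h S L', Φ h S L' ≤ B * (m : ℝ) ^ 2)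
    (hstep : ∀ h S L' x σ c, IsListing S → Adv h S L' (x :: σ) c → ∃ L'' c₀ c₁,
      c = c₀ + c₁ ∧ Adv (x :: h) (moveTo S x (R h S x)) L'' σ c₁ ∧
      (∀ L, IsListing L →
        2 * accessCost L x + mtfPotential (moveTo L x 0) L'' ≤ 4 * c₀ + mtfPotential L L') ∧
      (accessCost S x : ℝ) + Φ (x :: h) (moveTo S x (R h S x)) L'' ≤ κ * c₀ + Φ h S L')
    (hD : w / 2 * (m : ℝ) ^ 2 + w / κ * (B * (m : ℝ) ^ 2) + (m : ℝ) ^ 2 + |1 - w / 2| * m +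
      |1 - w / κ| * m ≤ ((w / 2 - 1) * β + (w / κ - 1)) * (m : ℝ) ^ 3)
    {σ : List α} {c : ℕ} (hs : s.Valid m β) (hA : Adv s.history s.simulated L' σ c) :
    (toggleCost m β R s σ : ℝ) ≤ w * c + s.potential m (w / 2) (w / κ) Φ L' +
      (|1 - w / κ| * ((m : ℝ) ^ 3 + m) + |1 - w / 2| * (β * (m : ℝ) ^ 3 + m) +
        w / 2 * (m : ℝ) ^ 2) := by
  have ha₁ : 0 ≤ w / 2 := by positivity
  have ha₂ : 0 ≤ w / κ := by positivity
  induction σ generalizing s L' c with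
  | nil =>
    have h1 := TogState.neg_potential_le (L' := L') ha₁ ha₂ hβ hΦ₀ hs
    have h2 : 0 ≤ w * c := by positivity
    simp only [toggleCost, Nat.cast_zero]
    linarith
  | cons x σ ih =>
    obtain ⟨v₁, p₁, t₁⟩ := TogState.potential_endTrusting (L' := L') hm hβ ha₁ ha₂ hΦ₀ hs
    obtain ⟨v₂, p₂, t₂, i₂⟩ := TogState.potential_endIgnoring (L' := L') hm ha₁ ha₂ hΦB hD v₁ t₁
    have e₁ : (s.endTrusting m).history = s.history ∧
        (s.endTrusting m).simulated = s.simulated := by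
      unfold TogState.endTrusting
      split_ifs <;> exact ⟨rfl, rfl⟩
    have e₂ : ((s.endTrusting m).endIgnoring m β).history = (s.endTrusting m).history ∧
        ((s.endTrusting m).endIgnoring m β).simulated = (s.endTrusting m).simulated := by
      generalize s.endTrusting m = t
      unfold TogState.endIgnoring
      split_ifs <;> exact ⟨rfl, rfl⟩
    -- Phase changes touch neither the history nor the simulated list, so the adversary does not
    -- notice them.
    rw [← e₁.1, ← e₁.2, ← e₂.1, ← e₂.2] at hA
    obtain ⟨L'', c₀, c₁, rfl, hA', hmtf, hΦ⟩ := hstep _ _ _ _ _ _ v₂.simulated hA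
    obtain ⟨v₃, p₃⟩ := TogState.potential_serve (w := w) hm hR hκ hw v₂ t₂ i₂
      (fun L hL => by exact_mod_cast hmtf L hL) hΦ
    have h3 := ih v₃ hA'
    rw [toggleCost]
    push_cast
    linarith

end Phases

/-! ### Long lists and the choice of the adversary -/

section Final

theorem exists_forall_mul_sq_le {D δ : ℝ} (hδ : 0 < δ) :
    ∃ m₀ : ℕ, ∀ m : ℕ, m₀ ≤ m → D * (m : ℝ) ^ 2 ≤ δ * (m : ℝ) ^ 3 := by
  obtain ⟨m₀, h⟩ := exists_nat_ge (D / δ)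
  refine ⟨m₀, fun m hm => ?_⟩
  have h1 : D / δ ≤ m := h.trans (by exact_mod_cast hm)
  rw [div_le_iff₀ hδ] at h1
  have h2 := mul_le_mul_of_nonneg_right h1 (by positivity : (0 : ℝ) ≤ (m : ℝ) ^ 2)
  linarith

theorem isListing_of_perm {m : ℕ} {L : List (Fin m)} (h : L.Perm (List.finRange m)) :
    IsListing L :=
  ⟨h.nodup_iff.2 (List.nodup_finRange m), fun x => h.mem_iff.2 (List.mem_finRange x)⟩

/-- Toggling from the start, on long lists. -/
theorem exists_toggleCost_le {β κ w B : ℝ} (hκ : 0 < κ) (hw : 0 ≤ w) (hβ : 0 ≤ β)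
    (hδ : 0 < (w / 2 - 1) * β + (w / κ - 1)) :
    ∃ m₀ : ℕ, ∀ m : ℕ, m₀ ≤ m → ∃ K : ℝ, ∀ R : Rule (Fin m), (∀ h L x, R h L x ≤ L.idxOf x) →
      ∀ (Adv : List (Fin m) → List (Fin m) → List (Fin m) → List (Fin m) → ℕ → Prop)
      (Φ : List (Fin m) → List (Fin m) → List (Fin m) → ℝ),
      (∀ h S L', 0 ≤ Φ h S L') → (∀ h S L', Φ h S L' ≤ B * (m : ℝ) ^ 2) →
      (∀ h S L' x σ c, IsListing S → Adv h S L' (x :: σ) c → ∃ L'' c₀ c₁,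
        c = c₀ + c₁ ∧ Adv (x :: h) (moveTo S x (R h S x)) L'' σ c₁ ∧
        (∀ L, IsListing L →
          2 * accessCost L x + mtfPotential (moveTo L x 0) L'' ≤ 4 * c₀ + mtfPotential L L') ∧
        (accessCost S x : ℝ) + Φ (x :: h) (moveTo S x (R h S x)) L'' ≤ κ * c₀ + Φ h S L') →
      ∀ L σ c, IsListing L → Adv [] L L σ c →
        (toggleCost m β R ⟨[], L, L, true, 0⟩ σ : ℝ) ≤ w * c + K := by
  -- All lower-order terms of a round, with `m` bounded by `m ^ 2`.
  obtain ⟨m₀, hm₀⟩ := exists_forall_mul_sq_le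
    (D := w / 2 + w / κ * B + 1 + |1 - w / 2| + |1 - w / κ|) hδ
  refine ⟨m₀, fun m hm => ⟨w / κ * (B * (m : ℝ) ^ 2) + (|1 - w / κ| * ((m : ℝ) ^ 3 + m) +
    |1 - w / 2| * (β * (m : ℝ) ^ 3 + m) + w / 2 * (m : ℝ) ^ 2),
    fun R hR Adv Φ hΦ₀ hΦB hstep L σ c hL hA => ?_⟩⟩
  have hsq : (m : ℝ) ≤ (m : ℝ) ^ 2 := by exact_mod_cast Nat.le_self_pow (by norm_num) m
  have hD := hm₀ m hm
  have h1 := mul_le_mul_of_nonneg_left hsq (abs_nonneg (1 - w / 2))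
  have h2 := mul_le_mul_of_nonneg_left hsq (abs_nonneg (1 - w / κ))
  have h3 := toggleCost_le (Φ := Φ) (B := B) (s := ⟨[], L, L, true, 0⟩) (L' := L)
    (Fintype.card_fin m) hR hκ hw hβ Adv hΦ₀ hΦB hstep (by linarith)
    ⟨hL, hL, fun _ => rfl, fun _ => by simp; positivity, by simp⟩ hA
  have h4 := mul_le_mul_of_nonneg_left (hΦB [] L L) (by positivity : 0 ≤ w / κ)
  simp only [TogState.potential, if_true, Nat.cast_zero, mul_zero, sub_zero] at h3
  linarith

/-- Toggling against the optimal offline algorithm. -/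
theorem toggleCost_le_opt {β : ℝ} (hβ : 0 ≤ β) {ε : ℝ} (hε : 0 < ε) :
    ∃ m₀ : ℕ, ∀ m : ℕ, m₀ ≤ m → ∃ K : ℝ, ∀ (R : Rule (Fin m)) (q : List (Fin m) → Fin m → Bool),
      IsAlternating R q → ∀ L σ, IsListing L →
        (toggleCost m β R ⟨[], L, L, true, 0⟩ σ : ℝ) ≤
          (2 + 2 / (4 + 5 * β) + ε) * opt L σ + K := by
  have hδ : 0 < ((2 + 2 / (4 + 5 * β) + ε) / 2 - 1) * β +
      ((2 + 2 / (4 + 5 * β) + ε) / (5 / 2) - 1) := by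
    -- The surplus of a round vanishes exactly at the claimed ratio, so only the `ε` part remains.
    have h1 : ((2 + 2 / (4 + 5 * β) + ε) / 2 - 1) * β +
      ((2 + 2 / (4 + 5 * β) + ε) / (5 / 2) - 1) = ε * (β / 2 + 2 / 5) := by
      have : 4 + 5 * β ≠ 0 := by positivity
      field_simp
      ring
    rw [h1]; positivity
  obtain ⟨m₀, h⟩ := exists_toggleCost_le (κ := 5 / 2) (w := 2 + 2 / (4 + 5 * β) + ε) (B := 5 / 4)
    (by norm_num) (by positivity) hβ hδ
  refine ⟨m₀, fun m hm => ?_⟩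
  obtain ⟨K, hK⟩ := h m hm
  refine ⟨K, fun R q hR L σ hL => hK R hR.le_idxOf
    (fun _ _ L' σ c => IsListing L' ∧ Serves L' σ c)
    (fun h S L' => (alternatingPotential (q h) S L' : ℝ) / 4) (fun _ _ _ => by positivity)
    (fun h S L' => ?_) ?_ L σ _ hL ⟨hL, serves_opt hL σ⟩⟩
  · have h1 := alternatingPotential_le (q h) S L'
    rw [Fintype.card_fin] at h1
    have h2 : (alternatingPotential (q h) S L' : ℝ) ≤ 5 * (m : ℝ) ^ 2 := by exact_mod_cast h1
    linarith
  · rintro h S L' x σ c hS ⟨hL', hs⟩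
    obtain ⟨k, L'', i, c', hex, hi, hs', rfl⟩ := hs.exists_access
    refine ⟨moveTo L'' x i, k + accessCost L'' x, c', rfl,
      ⟨(hL'.perm hex.perm).moveTo hi, hs'⟩, fun L hL => mtf_step hL hL' hex hi, ?_⟩
    have h1 := hR.step (h := h) hS hL' hex hi
    have h2 : (4 : ℝ) * accessCost S x +
        alternatingPotential (q (x :: h)) (moveTo S x (R h S x)) (moveTo L'' x i) ≤
      10 * (k + accessCost L'' x : ℕ) + alternatingPotential (q h) S L' := by exact_mod_cast h1
    linarith

/-- Toggling against the algorithm that is followed in trusting phases. -/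
theorem toggleCost_le_ruleCost {β : ℝ} (hβ : 0 ≤ β) {ε : ℝ} (hε : 0 < ε) :
    ∃ m₀ : ℕ, ∀ m : ℕ, m₀ ≤ m → ∃ K : ℝ, ∀ R : Rule (Fin m),
      (∀ h L x, R h L x ≤ L.idxOf x) → ∀ L σ, IsListing L →
        (toggleCost m β R ⟨[], L, L, true, 0⟩ σ : ℝ) ≤
          ((2 + 2 * β) / (2 + β) + ε) * ruleCost R [] L σ + K := by
  have hδ : 0 < (((2 + 2 * β) / (2 + β) + ε) / 2 - 1) * β +
      (((2 + 2 * β) / (2 + β) + ε) / 1 - 1) := by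
    have h1 : (((2 + 2 * β) / (2 + β) + ε) / 2 - 1) * β +
      (((2 + 2 * β) / (2 + β) + ε) / 1 - 1) = ε * (β / 2 + 1) := by
      have : 2 + β ≠ 0 := by positivity
      field_simp
      ring
    rw [h1]; positivity
  obtain ⟨m₀, h⟩ := exists_toggleCost_le (κ := 1) (w := (2 + 2 * β) / (2 + β) + ε) (B := 0)
    one_pos (by positivity) hβ hδ
  refine ⟨m₀, fun m hm => ?_⟩
  obtain ⟨K, hK⟩ := h m hm
  -- The adversary is `R` itself: its list is the simulated one, it makes no paid exchanges, and
  -- zero potential suffices for `κ = 1`.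
  refine ⟨K, fun R hR L σ hL => hK R hR
    (fun h S L' σ c => L' = S ∧ c = ruleCost R h S σ)
    (fun _ _ _ => 0) (fun _ _ _ => le_rfl) (fun _ _ _ => by simp) ?_ L σ _ hL ⟨rfl, rfl⟩⟩
  rintro h S L' x σ c hS ⟨rfl, rfl⟩
  refine ⟨_, accessCost L' x, _, rfl, ⟨rfl, rfl⟩, fun L hL => ?_, by simp⟩
  simpa using mtf_step hL hS (Exchanges.refl L') (hR h L' x)

/-- The least of three costs is at most their average, a third of the joint bound. -/
theorem ruleCost_le_of_trusted {m : ℕ} {L σ : List (Fin m)} (hL : IsListing L) {φ : List Bool}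
    (hφ : Trusted L φ σ) :
    (ruleCost (decode φ).rule [] L σ : ℝ) ≤ 5 / 3 * opt L σ + (m : ℝ) ^ 2 := by
  have h1 := joint_competitive hL (serves_opt hL σ)
  have h2 := hφ .timestamp
  have h3 := hφ .mtfo
  have h4 := hφ .mtfe
  simp only [Candidate.rule] at h2 h3 h4
  rw [Fintype.card_fin] at h1
  have h5 : 6 * ruleCost (decode φ).rule [] L σ ≤ 10 * opt L σ + 5 * m ^ 2 := by
    simp only [Candidate.rule] at *
    omega
  have h6 : (6 : ℝ) * ruleCost (decode φ).rule [] L σ ≤ 10 * opt L σ + 5 * (m : ℝ) ^ 2 := by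
    exact_mod_cast h5
  have : (0 : ℝ) ≤ (m : ℝ) ^ 2 := by positivity
  linarith

theorem togCompetitive {β : ℝ} (hβ : 0 ≤ β) :
    TogCompetitive β (5 / 3 + 5 * β / (6 + 3 * β)) (2 + 2 / (4 + 5 * β)) := by
  intro ε hε
  obtain ⟨m₁, h₁⟩ := toggleCost_le_opt hβ hε
  -- The error is multiplied by `5 / 3` when the named candidate is compared with the optimum.
  obtain ⟨m₂, h₂⟩ := toggleCost_le_ruleCost hβ (ε := 3 * ε / 5) (by positivity)
  refine ⟨max m₁ m₂, fun m hm => ?_⟩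
  obtain ⟨K₁, h₁⟩ := h₁ m (le_of_max_le_left hm)
  obtain ⟨K₂, h₂⟩ := h₂ m (le_of_max_le_right hm)
  set ρ := (2 + 2 * β) / (2 + β) + 3 * ε / 5 with hρ
  have hρ0 : 0 ≤ ρ := by positivity
  have hρr : ρ * (5 / 3) = 5 / 3 + 5 * β / (6 + 3 * β) + ε := by
    have h1 : 2 + β ≠ 0 := by positivity
    have h2 : 6 + 3 * β ≠ 0 := by positivity
    rw [hρ]
    field_simp
    ring
  refine ⟨|K₁| + |K₂| + ρ * (m : ℝ) ^ 2 + (m : ℝ) ^ 2, fun L hp σ => ?_⟩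
  have hL := isListing_of_perm hp
  have hK₁ := le_abs_self K₁
  have hK₂ := le_abs_self K₂
  have hK₁' := abs_nonneg K₁
  have hK₂' := abs_nonneg K₂
  have hm0 : 0 ≤ ρ * (m : ℝ) ^ 2 := by positivity
  have hm1 : 0 ≤ (m : ℝ) ^ 2 := by positivity
  have hopt : (0 : ℝ) ≤ opt L σ := Nat.cast_nonneg _
  have hrβ : 0 ≤ (5 * β / (6 + 3 * β) + ε) * opt L σ := by positivity
  have hwβ : 0 ≤ (2 / (4 + 5 * β) + ε) * opt L σ := by positivity
  constructor
  · intro φ hφ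
    have h3 := ruleCost_le_of_trusted hL hφ
    have h4 := mul_le_mul_of_nonneg_left h3 hρ0
    have h5 : ρ * (5 / 3 * opt L σ + (m : ℝ) ^ 2) =
        (5 / 3 + 5 * β / (6 + 3 * β) + ε) * opt L σ + ρ * (m : ℝ) ^ 2 := by
      rw [← hρr]; ring
    unfold togCost
    rcases hd : decode φ with _ | _ | _ <;> simp only [hd, Candidate.rule] at h3 h4 ⊢
    · linarith
    · have := h₂ mtfo mtfo_isAlternating.le_idxOf L σ hL
      linarith
    · have := h₂ mtfe mtfe_isAlternating.le_idxOf L σ hL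
      linarith
  · intro φ
    unfold togCost
    rcases decode φ with _ | _ | _
    · have h3 := timestamp_competitive hL (serves_opt hL σ)
      rw [Fintype.card_fin] at h3
      have h4 : (ruleCost timestamp [] L σ : ℝ) ≤ 2 * opt L σ + (m : ℝ) ^ 2 := by
        exact_mod_cast h3
      simp only
      linarith
    · have := h₁ mtfo _ mtfo_isAlternating L σ hL
      simp only
      linarith
    · have := h₁ mtfe _ mtfe_isAlternating L σ hL
      simp only
      linarith

end Final

end ListUpdate

theorem mainTheorem6 :
    (∀ β : ℝ, 0 ≤ β →
      ListUpdate.TogCompetitive β (5 / 3 + 5 * β / (6 + 3 * β)) (2 + 2 / (4 + 5 * β))) ∧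
    (∀ r : ℝ, 5 / 3 ≤ r → r ≤ 2 →
      ∃ β : ℝ, 0 ≤ β ∧ β ≤ 1 / 2 ∧ r = 5 / 3 + 5 * β / (6 + 3 * β) ∧
        ListUpdate.TogCompetitive β r (2 + (10 - 3 * r) / (9 * r - 5))) := by
  refine ⟨fun β hβ => ListUpdate.togCompetitive hβ, fun r hr hr2 => ?_⟩
  have hden : 0 < 10 - 3 * r := by linarith
  -- This is the equation for `r` with the denominator cleared, solved for `β`.
  obtain ⟨β, hβr⟩ : ∃ β, β * (10 - 3 * r) = 6 * r - 10 :=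
    ⟨(6 * r - 10) / (10 - 3 * r), div_mul_cancel₀ _ hden.ne'⟩
  have hβ : 0 ≤ β := nonneg_of_mul_nonneg_left (by linarith) hden
  have e1 : r = 5 / 3 + 5 * β / (6 + 3 * β) := by
    have h : 6 + 3 * β ≠ 0 := by positivity
    rw [← sub_eq_iff_eq_add', eq_div_iff h]
    linear_combination -hβr
  have e2 : 2 / (4 + 5 * β) = (10 - 3 * r) / (9 * r - 5) := by
    rw [div_eq_div_iff (by positivity) (by linarith)]
    linear_combination -5 * hβr
  refine ⟨β, hβ, le_of_mul_le_mul_right (by linarith) hden, e1, ?_⟩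
  have h := ListUpdate.togCompetitive hβ
  rwa [← e1, e2] at h
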